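/- All groups are abelian and written additively. A group $G$ is called *Bassian* if, for every subgroup $N$ of $G$, the existence of an injective homomorphism $G\to G/N$ forces $N=\{0\}$. A torsion group $E$ is called *elementary* if $pE_p=\{0\}$ for every prime $p$, where $E_p$ denotes the $p$-primary component of $E$. A group $G$ is called a *B+E-group* if it has a direct decomposition $G=A\oplus E$ with $A$ Bassian and $E$ elementary. Every subgroup of a B+E-group is also a B+E-group. -/

import Mathlib

/-- An abelian group `G` is Bassian if the existence of an injective homomorphism `G → G / N`,
for a subgroup `N` of `G`, forces `N = 0`. -/
def IsBassian (G : Type*) [AddCommGroup G] : Prop :=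
  ∀ N : AddSubgroup G, (∃ f : G →+ G ⧸ N, Function.Injective f) → N = ⊥

/-- An abelian group `T` is elementary if it is torsion and each of its `p`-primary components
`T_p` is bounded by `p`, that is, `p T_p = 0`. -/
def IsElementaryTorsion (T : Type*) [AddCommGroup T] : Prop :=
  IsAddTorsion T ∧
    ∀ p : ℕ, p.Prime → ∀ x ∈ AddCommGroup.primaryComponent T p, p • x = 0

/-- An abelian group `G` is a B+E-group if it is the internal direct sum `G = A ⊕ E` of a Bassian
subgroup `A` and an elementary subgroup `E`. -/
def IsBPlusE (G : Type*) [AddCommGroup G] : Prop :=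
  ∃ A E : AddSubgroup G, IsCompl A E ∧ IsBassian A ∧ IsElementaryTorsion E

/-! A group is Bassian exactly when its torsion-free rank and all its primary components are finite
(`IsBassian.rank_lt_aleph0`, `IsBassian.finite_primaryComponent`, `isBassian_of_finite`). Both
conditions pass to subgroups.

Necessity rests on `not_isBassian_of_homs`. An infinite independent family can be mapped to a
countable divisible group in two ways: injectively on its span, or onto every value needed while
killing one member. Divisibility extends both maps to `G`, and together they embed `G` in a proper
quotient.

For the theorem, semisimplicity of `E` gives `E = (H ∩ E) ⊕ C`, whence `H = (H ∩ (A + C)) ⊕ (H ∩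
E)`. The first summand meets `E` trivially, so projection along `E` embeds it in `A`. -/

/-! ### Extension of homomorphisms and a criterion for not being Bassian -/

/-- A family in a divisible group satisfying all the linear relations of a family `y` in `G` is the
image of `y` under a homomorphism defined on `G`. -/
lemma exists_addMonoidHom_of_relations {ι G D : Type*} [AddCommGroup G] [AddCommGroup D]
    [DivisibleBy D ℤ] (y : ι → G) (d : ι → D)
    (h : ∀ (F : Finset ι) (a : ι → ℤ), ∑ i ∈ F, a i • y i = 0 → ∑ i ∈ F, a i • d i = 0) :
    ∃ Φ : G →+ D, ∀ i, Φ (y i) = d i := by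
  set ly := Finsupp.linearCombination ℤ y
  set ld := Finsupp.linearCombination ℤ d
  have hle : LinearMap.ker ly ≤ LinearMap.ker ld := fun a ha => h a.support a ha
  obtain ⟨φ, hφ⟩ := (Module.Baer.of_divisible D).extension_property
    ((LinearMap.ker ly).liftQ ly le_rfl)
    (LinearMap.ker_eq_bot.1 (Submodule.ker_liftQ_eq_bot _ _ _ le_rfl))
    ((LinearMap.ker ly).liftQ ld hle)
  refine ⟨φ.toAddMonoidHom, fun i => ?_⟩
  have := LinearMap.congr_fun hφ (Submodule.Quotient.mk (Finsupp.single i 1))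
  simpa [ly, ld] using this

/-- If two homomorphisms `Φ`, `Ψ` from `G` are such that `Φ` attains on the subgroup `C` all the
values of `Ψ - Φ` and is not injective on `C`, while `Ψ` is injective on `C`, then `G` is not
Bassian. -/
lemma not_isBassian_of_homs {G D : Type*} [AddCommGroup G] [AddCommGroup D] (C : AddSubgroup G)
    (Φ Ψ : G →+ D) (hsurj : ∀ g, ∃ c ∈ C, Φ c = Ψ g - Φ g) (hinj : ∀ c ∈ C, Ψ c = 0 → c = 0)
    {x : G} (hxC : x ∈ C) (hx0 : x ≠ 0) (hx : Φ x = 0) : ¬ IsBassian G := by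
  intro hG
  -- The coordinate in `G ⧸ C` ignores corrections by elements of `C` and forces the kernel of `W`
  -- into `C`.
  set T : G →+ D × (G ⧸ C) := Φ.prod (QuotientAddGroup.mk' C)
  set W : G →+ D × (G ⧸ C) := Ψ.prod (QuotientAddGroup.mk' C)
  have hWT : ∀ g, W g ∈ T.range := by
    intro g
    obtain ⟨c, hc, h⟩ := hsurj g
    refine ⟨g + c, Prod.ext ?_ ?_⟩
    · simp [T, W, h]
    · have : (c : G ⧸ C) = 0 := (QuotientAddGroup.eq_zero_iff c).2 hc
      simp [T, W, this]
  have hW : Function.Injective W := by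
    rw [injective_iff_map_eq_zero]
    intro g hg
    have h1 : Ψ g = 0 := congrArg Prod.fst hg
    have h2 : (g : G ⧸ C) = 0 := congrArg Prod.snd hg
    exact hinj g ((QuotientAddGroup.eq_zero_iff g).1 h2) h1
  have hker := hG T.ker ⟨(QuotientAddGroup.quotientKerEquivRange T).symm.toAddMonoidHom.comp
    (W.codRestrict T.range hWT), by
      intro a b hab
      have := (QuotientAddGroup.quotientKerEquivRange T).symm.injective hab
      exact hW (congrArg Subtype.val this)⟩
  have hxT : x ∈ T.ker := by
    refine Prod.ext hx ?_
    exact (QuotientAddGroup.eq_zero_iff x).2 hxC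
  rw [hker] at hxT
  exact hx0 hxT

noncomputable instance Finsupp.divisibleByRat {ι : Type*} : DivisibleBy (ι →₀ ℚ) ℤ where
  div f n := (n : ℚ)⁻¹ • f
  div_zero f := by simp
  div_cancel {n} f hn := by
    ext i
    have : (n : ℚ) ≠ 0 := by exact_mod_cast hn
    simp [this]

/-! ### Finiteness of the torsion-free rank -/

/-- A Bassian group has finite torsion-free rank. -/
lemma IsBassian.rank_lt_aleph0 {G : Type*} [AddCommGroup G] (hG : IsBassian G) :
    Module.rank ℤ G < Cardinal.aleph0 := by
  by_contra! hr
  obtain ⟨s, hs, hli⟩ := exists_set_linearIndependent ℤ G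
  rw [← hs, Cardinal.aleph0_le_mk_iff] at hr
  let y : ℕ → G := fun n => (Infinite.natEmbedding s n : G)
  have hy : LinearIndependent ℤ y := hli.comp _ (Infinite.natEmbedding s).injective
  have hrel : ∀ (F : Finset ℕ) (a : ℕ → ℤ), ∑ i ∈ F, a i • y i = 0 → ∀ i ∈ F, a i = 0 :=
    fun F a => linearIndependent_iff'.1 hy F a
  obtain ⟨e, he⟩ := exists_surjective_nat (ℕ →₀ ℚ)
  -- Index 0 supplies the kernel element `y 0`; the shifted indices still exhaust the countable
  -- target.
  let d : ℕ → (ℕ →₀ ℚ) := fun n => n.casesOn 0 e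
  have key : ∀ d : ℕ → (ℕ →₀ ℚ), ∃ Φ : G →+ (ℕ →₀ ℚ), ∀ i, Φ (y i) = d i := fun d =>
    exists_addMonoidHom_of_relations y d fun F a h =>
      Finset.sum_eq_zero fun i hi => by rw [hrel F a h i hi, zero_smul]
  obtain ⟨Φ, hΦ⟩ := key d
  obtain ⟨Ψ, hΨ⟩ := key fun i => Finsupp.single i 1
  refine not_isBassian_of_homs (Submodule.span ℤ (Set.range y)).toAddSubgroup Φ Ψ ?_ ?_
    (x := y 0) (Submodule.subset_span ⟨0, rfl⟩) (hy.ne_zero 0) (hΦ 0) hG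
  · intro g
    obtain ⟨n, hn⟩ := he (Ψ g - Φ g)
    exact ⟨y (n + 1), Submodule.subset_span ⟨_, rfl⟩, by rw [hΦ, ← hn]⟩
  · intro c hc h0
    obtain ⟨a, rfl⟩ := Finsupp.mem_span_range_iff_exists_finsupp.1 hc
    have : a = 0 := by
      ext i
      have := DFunLike.congr_fun h0 i
      simpa [Finsupp.sum, map_sum, hΨ, Finsupp.finsetSum_apply, Finsupp.single_apply] using this
    simp [this]

/-! ### Independent sequences in primary groups -/

/-- The subgroup of `⨁ ℚ` of the elements whose coordinates have denominator prime to `p`. -/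
def pIntegralFinsupp (p : ℕ) (hp : p.Prime) : AddSubgroup (ℕ →₀ ℚ) where
  carrier := {f | ∀ i, ¬ p ∣ (f i).den}
  zero_mem' := fun i => by simpa using hp.one_lt.ne'
  add_mem' := fun {f g} hf hg i h => by
    rcases hp.dvd_mul.1 (h.trans (Rat.add_den_dvd (f i) (g i))) with h | h
    · exact hf i h
    · exact hg i h
  neg_mem' := fun {f} hf i => by simpa using hf i

/-- For each prime `p` there is a countable divisible `p`-group of infinite rank. -/
lemma exists_divisible_primary (p : ℕ) (hp : p.Prime) :
    ∃ (D : Type) (_ : AddCommGroup D) (_ : DivisibleBy D ℤ), Countable D ∧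
      (∀ d : D, ∃ k : ℕ, p ^ k • d = 0) ∧
      ∀ k : ℕ → ℕ, ∃ u : ℕ → D, (∀ i, p ^ (k i + 1) • u i = 0) ∧
        ∀ (F : Finset ℕ) (a : ℕ → ℤ), ∑ i ∈ F, a i • u i = 0 →
          ∀ i ∈ F, (p : ℤ) ^ (k i + 1) ∣ a i := by
  have hp0 : (p : ℚ) ≠ 0 := by exact_mod_cast hp.ne_zero
  set L := pIntegralFinsupp p hp
  -- This is a countable direct sum of Prüfer groups, since `ℚ` modulo the `p`-integral rationals is
  -- `ℤ(p^∞)`.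
  refine ⟨(ℕ →₀ ℚ) ⧸ L, inferInstance, (QuotientAddGroup.mk'_surjective L).divisibleBy _ fun f n =>
    map_zsmul (QuotientAddGroup.mk' L) n f,
    Quotient.countable, ?_, ?_⟩
  · intro d
    obtain ⟨f, rfl⟩ := QuotientAddGroup.mk_surjective d
    have hN : ∏ i ∈ f.support, (f i).den ≠ 0 := Finset.prod_ne_zero_iff.2 fun i _ => (f i).den_nz
    obtain ⟨k, m, hm, hkm⟩ := Nat.exists_eq_pow_mul_and_not_dvd hN p hp.ne_one
    refine ⟨k, ?_⟩
    rw [← QuotientAddGroup.mk_nsmul, QuotientAddGroup.eq_zero_iff]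
    intro i hi
    by_cases h0 : f i = 0
    · simp [h0, hp.ne_one] at hi
    obtain ⟨c, hc⟩ := Finset.dvd_prod_of_mem (fun i => (f i).den) (Finsupp.mem_support_iff.2 h0)
    have hm0 : (m : ℚ) ≠ 0 := by
      rintro h
      exact hm (by simp [Nat.cast_eq_zero.1 h])
    have : (p ^ k • f) i = (((f i).num * c : ℤ) : ℚ) / ((m : ℤ) : ℚ) := by
      have h1 : ((p : ℚ) ^ k * m) = (f i).den * c := by
        exact_mod_cast hkm.symm.trans hc
      have h2 := Rat.den_mul_eq_num (f i)
      rw [eq_div_iff (by exact_mod_cast hm0)]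
      push_cast
      rw [← h2, Pi.smul_apply, nsmul_eq_mul]
      push_cast
      linear_combination (f i) * h1
    rw [this] at hi
    have h3 := Rat.den_dvd ((f i).num * c) m
    exact hm (hi.trans (by exact_mod_cast h3))
  · intro k
    refine ⟨fun i => ((Finsupp.single i (((p : ℚ) ^ (k i + 1))⁻¹) : ℕ →₀ ℚ) : (ℕ →₀ ℚ) ⧸ L),
      fun i => ?_, fun F a h j hj => ?_⟩
    · rw [← QuotientAddGroup.mk_nsmul, QuotientAddGroup.eq_zero_iff]
      intro j
      have : (p ^ (k i + 1) • Finsupp.single i (((p : ℚ) ^ (k i + 1))⁻¹) : ℕ →₀ ℚ)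
          = Finsupp.single i 1 := by
        ext j
        simp [Finsupp.single_apply, hp0]
      rw [this, Finsupp.single_apply]
      split_ifs <;> simpa using hp.ne_one
    · have h' : ((∑ i ∈ F, a i • Finsupp.single i (((p : ℚ) ^ (k i + 1))⁻¹) : ℕ →₀ ℚ)
          : (ℕ →₀ ℚ) ⧸ L) = 0 := by
        rw [← h]
        exact map_sum (QuotientAddGroup.mk' L) _ _
      rw [QuotientAddGroup.eq_zero_iff] at h'
      have h2 := h' j
      set q : ℚ := (∑ i ∈ F, a i • Finsupp.single i (((p : ℚ) ^ (k i + 1))⁻¹) : ℕ →₀ ℚ) j with hq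
      have hqa : q * (p : ℚ) ^ (k j + 1) = a j := by
        rw [hq]
        simp [Finsupp.finsetSum_apply, Finsupp.single_apply, hj, hp0]
      have h3 : (p : ℤ) ^ (k j + 1) ∣ a j * q.den := by
        refine ⟨q.num, ?_⟩
        have h4 := Rat.den_mul_eq_num q
        have : ((a j * q.den : ℤ) : ℚ) = (((p : ℤ) ^ (k j + 1) * q.num : ℤ) : ℚ) := by
          push_cast
          rw [← h4, ← hqa]
          ring
        exact_mod_cast this
      refine IsCoprime.dvd_of_dvd_mul_right (IsCoprime.pow_left ?_) h3
      exact Nat.isCoprime_iff_coprime.2 ((Nat.Prime.coprime_iff_not_dvd hp).2 h2)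

/-- Given infinite sets of elements of order `p`, one can choose a member of each so that the chosen
family is linearly independent modulo `p`. -/
lemma exists_independent_sequence {M : Type*} [AddCommGroup M] {p : ℕ} (hp : p.Prime)
    (X : ℕ → Set M) (hX : ∀ n, ∀ x ∈ X n, p • x = 0) (hinf : ∀ n, (X n).Infinite) :
    ∃ x : ℕ → M, (∀ n, x n ∈ X n) ∧ ∀ (F : Finset ℕ) (b : ℕ → ℤ), ∑ i ∈ F, b i • x i = 0 →
      ∀ i ∈ F, (p : ℤ) ∣ b i := by
  classical
  have hstep : ∀ (n : ℕ) (K : {K : AddSubgroup M // (K : Set M).Finite}), ∃ x ∈ X n, x ∉ K.1 :=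
    fun n K => (hinf n).exists_notMem_finite K.2
  choose c hcX hcK using hstep
  have hfin : ∀ (K : {K : AddSubgroup M // (K : Set M).Finite}) (x : M), p • x = 0 →
      ((K.1 ⊔ AddSubgroup.zmultiples x : AddSubgroup M) : Set M).Finite := by
    intro K x hx
    have h2 : (AddSubgroup.zmultiples x : Set M).Finite :=
      finite_zmultiples.2 (isOfFinAddOrder_iff_nsmul_eq_zero.2 ⟨p, hp.pos, hx⟩)
    refine (Set.Finite.image2 (· + ·) K.2 h2).subset ?_
    intro z hz
    obtain ⟨a, ha, b, hb, rfl⟩ := AddSubgroup.mem_sup.1 hz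
    exact ⟨a, ha, b, hb, rfl⟩
  let K : ℕ → {K : AddSubgroup M // (K : Set M).Finite} := fun n =>
    Nat.rec ⟨⊥, by simp⟩ (fun n K => ⟨K.1 ⊔ AddSubgroup.zmultiples (c n K),
      hfin K _ (hX n _ (hcX n K))⟩) n
  have hKsucc : ∀ n, (K (n + 1)).1 = (K n).1 ⊔ AddSubgroup.zmultiples (c n (K n)) := fun n => rfl
  have hmono : Monotone fun n => (K n).1 := monotone_nat_of_le_succ fun n => by
    rw [hKsucc]; exact le_sup_left
  have hmem : ∀ i j, i < j → c i (K i) ∈ (K j).1 := fun i j hij => by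
    have h1 : c i (K i) ∈ (K (i + 1)).1 := by
      rw [hKsucc]
      exact (le_sup_right : _ ≤ (K i).1 ⊔ _) (AddSubgroup.mem_zmultiples _)
    exact hmono (Nat.succ_le_of_lt hij) h1
  refine ⟨fun n => c n (K n), fun n => hcX _ _, fun F b h => ?_⟩
  by_contra! hne
  have hne' : (F.filter fun i => ¬ (p : ℤ) ∣ b i).Nonempty := by
    obtain ⟨i, hi, hb⟩ := hne
    exact ⟨i, Finset.mem_filter.2 ⟨hi, hb⟩⟩
  -- At the largest index with coefficient prime to `p`, later terms vanish and earlier ones lie in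
  -- `K j`, which the choice at `j` avoided.
  obtain ⟨j, hj, hmax⟩ := Finset.exists_max_image _ id hne'
  rw [Finset.mem_filter] at hj
  have hjK : b j • c j (K j) ∈ (K j).1 := by
    rw [← Finset.add_sum_erase F _ hj.1] at h
    rw [eq_neg_of_add_eq_zero_left h]
    refine neg_mem (sum_mem fun i hi => ?_)
    rw [Finset.mem_erase] at hi
    rcases lt_or_gt_of_ne hi.1 with hlt | hgt
    · exact zsmul_mem (hmem i j hlt) _
    · have hd : (p : ℤ) ∣ b i := by
        by_contra hd
        exact absurd (hmax i (Finset.mem_filter.2 ⟨hi.2, hd⟩)) (by simpa using hgt)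
      obtain ⟨e, he⟩ := hd
      rw [he, mul_comm, mul_smul, natCast_zsmul, hX i _ (hcX _ _), smul_zero]
      exact zero_mem _
  obtain ⟨v, w, hvw⟩ := ((Nat.prime_iff_prime_int.1 hp).coprime_iff_not_dvd).2 hj.2
  refine hcK j (K j) ?_
  have : c j (K j) = w • b j • c j (K j) := by
    conv_lhs => rw [← one_smul ℤ (c j (K j)), ← hvw, add_smul, mul_smul, natCast_zsmul,
      hX j _ (hcX _ _), smul_zero, zero_add, mul_smul]
  rw [this]
  exact zsmul_mem hjK w

/-- If the elements `p ^ k i • y i` are linearly independent modulo `p`, then the coefficients of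
each linear relation of the family `y` are divisible by `p ^ (k i + 1)`. -/
lemma pow_dvd_of_relation {M : Type*} [AddCommGroup M] {p : ℕ} (hp0 : p ≠ 0) (y : ℕ → M) (k : ℕ → ℕ)
    (hs : ∀ (F : Finset ℕ) (b : ℕ → ℤ), ∑ i ∈ F, b i • p ^ k i • y i = 0 →
      ∀ i ∈ F, (p : ℤ) ∣ b i)
    (F : Finset ℕ) (a : ℕ → ℤ) (h : ∑ i ∈ F, a i • y i = 0) :
    ∀ i ∈ F, (p : ℤ) ^ (k i + 1) ∣ a i := by
  -- A large `t` makes the hypothesis trivial. Multiplying the relation by `p ^ t` turns it into one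
  -- among the `p ^ k i • y i`, whose independence removes one factor `p`.
  have key : ∀ t : ℕ, (∀ i ∈ F, (p : ℤ) ^ (k i + 1) ∣ p ^ t * a i) →
      ∀ i ∈ F, (p : ℤ) ^ (k i + 1) ∣ a i := by
    intro t
    induction t with
    | zero => simp
    | succ t ih =>
      intro ht
      have hp0' : (p : ℤ) ≠ 0 := by exact_mod_cast hp0
      have hb : ∀ i, ∃ b : ℤ, i ∈ F → (p : ℤ) ^ t * a i = b * p ^ k i := by
        intro i
        by_cases hi : i ∈ F
        · obtain ⟨b, hb⟩ := ht i hi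
          refine ⟨b, fun _ => mul_left_cancel₀ hp0' ?_⟩
          linear_combination hb
        · exact ⟨0, fun h => absurd h hi⟩
      choose b hb using hb
      have hsum : ∑ i ∈ F, b i • p ^ k i • y i = 0 := by
        have h1 : (p : ℤ) ^ t • ∑ i ∈ F, a i • y i = 0 := by rw [h, smul_zero]
        rw [Finset.smul_sum] at h1
        rw [← h1]
        refine Finset.sum_congr rfl fun i hi => ?_
        rw [← natCast_zsmul, smul_smul, smul_smul, hb i hi]
        push_cast
        rfl
      refine ih fun i hi => ?_
      rw [hb i hi, pow_succ, mul_comm (b i)]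
      exact mul_dvd_mul_left _ (hs F b hsum i hi)
  refine key (∑ i ∈ F, (k i + 1)) fun i hi => Dvd.dvd.mul_right (pow_dvd_pow _ ?_) _
  exact Finset.single_le_sum (f := fun i => k i + 1) (fun _ _ => Nat.zero_le _) hi

lemma zsmul_eq_zero_of_pow_dvd {A : Type*} [AddCommGroup A] {p n : ℕ} {x : A} {a : ℤ}
    (hx : p ^ n • x = 0) (ha : (p : ℤ) ^ n ∣ a) : a • x = 0 := by
  obtain ⟨b, rfl⟩ := ha
  rw [mul_comm, mul_smul, ← Nat.cast_pow, natCast_zsmul, hx, smul_zero]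

/-- A group `G` is not Bassian if it contains a `p`-primary sequence `y` whose linear relations,
even modulo a subgroup, are the trivial ones, and which has enough room for the values of
homomorphisms into a divisible group. -/
lemma not_isBassian_of_sequence {G M D : Type*} [AddCommGroup G] [AddCommGroup M] [AddCommGroup D]
    [DivisibleBy D ℤ] {p : ℕ} (hp : p.Prime) (q : G →+ M) (y : ℕ → G) (k : ℕ → ℕ)
    (hy : ∀ i, p ^ (k i + 1) • y i = 0)
    (hrel : ∀ (F : Finset ℕ) (a : ℕ → ℤ), ∑ i ∈ F, a i • q (y i) = 0 →
      ∀ i ∈ F, (p : ℤ) ^ (k i + 1) ∣ a i)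
    (d : ℕ → D) (hd : ∀ i, p ^ (k i + 1) • d i = 0) (hd0 : d 0 = 0)
    (hsurj : ∀ (φ : M →+ D) (m : M), ∃ i, d i = φ m)
    (u : ℕ → D) (hu : ∀ i, p ^ (k i + 1) • u i = 0)
    (hurel : ∀ (F : Finset ℕ) (a : ℕ → ℤ), ∑ i ∈ F, a i • u i = 0 →
      ∀ i ∈ F, (p : ℤ) ^ (k i + 1) ∣ a i) : ¬ IsBassian G := by
  have hext : ∀ d : ℕ → D, (∀ i, p ^ (k i + 1) • d i = 0) →
      ∃ Φ : M →+ D, ∀ i, Φ (q (y i)) = d i := fun d hd =>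
    exists_addMonoidHom_of_relations (fun i => q (y i)) d fun F a h =>
      Finset.sum_eq_zero fun i hi => zsmul_eq_zero_of_pow_dvd (hd i) (hrel F a h i hi)
  obtain ⟨Φ, hΦ⟩ := hext d hd
  obtain ⟨Ψ, hΨ⟩ := hext u hu
  refine not_isBassian_of_homs (Submodule.span ℤ (Set.range y)).toAddSubgroup (Φ.comp q)
    (Ψ.comp q) ?_ ?_ (x := y 0) (Submodule.subset_span ⟨0, rfl⟩) ?_ ((hΦ 0).trans hd0)
  · intro g
    obtain ⟨n, hn⟩ := hsurj (Ψ - Φ) (q g)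
    exact ⟨y n, Submodule.subset_span ⟨_, rfl⟩, by simpa [hΦ] using hn⟩
  · intro c hc h0
    obtain ⟨a, rfl⟩ := Finsupp.mem_span_range_iff_exists_finsupp.1 hc
    have h1 : ∑ i ∈ a.support, a i • u i = 0 := by
      rw [← h0, Finsupp.sum, map_sum]
      exact Finset.sum_congr rfl fun i _ => by simp [hΨ]
    exact Finset.sum_eq_zero fun i hi => zsmul_eq_zero_of_pow_dvd (hy i) (hurel _ _ h1 i hi)
  · intro h0
    have := hrel {0} (fun _ => 1) (by simp [h0]) 0 (by simp)
    have h1 : p ^ (k 0 + 1) ∣ 1 := by exact_mod_cast this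
    exact (Nat.one_lt_pow (Nat.succ_ne_zero _) hp.one_lt).ne' (Nat.dvd_one.1 h1)

/-! ### Finiteness of the primary components -/

/-- The elements killed by `p` and divisible by `p ^ n`. -/
def divisibleSocle (G : Type*) [AddCommGroup G] (p n : ℕ) : AddSubgroup G where
  carrier := {x | p • x = 0 ∧ ∃ g, p ^ n • g = x}
  zero_mem' := ⟨smul_zero _, 0, smul_zero _⟩
  add_mem' := by
    rintro _ _ ⟨hx, a, rfl⟩ ⟨hy, b, rfl⟩
    exact ⟨by rw [smul_add, hx, hy, add_zero], a + b, smul_add _ _ _⟩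
  neg_mem' := by
    rintro _ ⟨hx, a, rfl⟩
    exact ⟨by rw [smul_neg, hx, neg_zero], -a, smul_neg _ _⟩

lemma divisibleSocle_antitone (G : Type*) [AddCommGroup G] (p : ℕ) :
    Antitone (divisibleSocle G p) := by
  rintro m n hmn _ ⟨hx, g, rfl⟩
  refine ⟨hx, p ^ (n - m) • g, ?_⟩
  rw [smul_smul, ← pow_add, Nat.add_sub_cancel' hmn]

/-- Otherwise infinitely many of these elements survive modulo `p ^ (n + 1) G`, and their `p ^ n`-th
roots stay independent there. Homomorphisms from that quotient take only values killed by `p ^ (n +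
1)`, which these roots can all attain. -/
lemma IsBassian.finite_divisibleSocle_of_succ {G : Type*} [AddCommGroup G] (hG : IsBassian G)
    {p : ℕ} (hp : p.Prime) (n : ℕ) (hn : (divisibleSocle G p (n + 1) : Set G).Finite) :
    (divisibleSocle G p n : Set G).Finite := by
  by_contra hinf
  set q := QuotientAddGroup.mk' (nsmulAddMonoidHom (α := G) (p ^ (n + 1))).range
  have hq : ∀ x, q x = 0 → ∃ g, p ^ (n + 1) • g = x := fun x hx =>
    (QuotientAddGroup.eq_zero_iff x).1 hx
  have hqinf : (q '' (divisibleSocle G p n : Set G)).Infinite := by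
    intro hfin
    refine hinf (Set.Finite.of_finite_fibers q hfin ?_)
    rintro _ ⟨x, hx, rfl⟩
    refine (hn.image (x + ·)).subset ?_
    rintro z ⟨hz, hzx⟩
    have hzx : q z = q x := hzx
    refine ⟨z - x, ⟨?_, hq _ ?_⟩, by simp⟩
    · rw [smul_sub, hz.1, hx.1, sub_zero]
    · rw [map_sub, hzx, sub_self]
  obtain ⟨s, hs, hind⟩ := exists_independent_sequence hp
    (fun _ => q '' (divisibleSocle G p n : Set G)) (by
      rintro _ _ ⟨x, hx, rfl⟩
      rw [← map_nsmul, hx.1, map_zero]) (fun _ => hqinf)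
  have hy : ∀ i, ∃ y, p ^ (n + 1) • y = 0 ∧ p ^ n • q y = s i := by
    intro i
    obtain ⟨_, ⟨hx, y, rfl⟩, h⟩ := hs i
    refine ⟨y, ?_, by rw [← h, map_nsmul]⟩
    rw [pow_succ', mul_smul, hx]
  choose y hy hys using hy
  obtain ⟨D, _, _, _, -, hD⟩ := exists_divisible_primary p hp
  obtain ⟨u, hu, hurel⟩ := hD fun _ => n
  have : Nonempty {x : D // p ^ (n + 1) • x = 0} := ⟨⟨0, smul_zero _⟩⟩
  obtain ⟨e, he⟩ := exists_surjective_nat {x : D // p ^ (n + 1) • x = 0}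
  refine not_isBassian_of_sequence hp q y (fun _ => n) hy ?_
    (fun i => i.casesOn 0 fun j => (e j).1) ?_ rfl ?_ u hu hurel hG
  · refine pow_dvd_of_relation hp.ne_zero (fun i => q (y i)) (fun _ => n) fun F b h => ?_
    simp only [hys] at h
    exact hind F b h
  · rintro (_ | j)
    · exact smul_zero _
    · exact (e j).2
  · intro φ m
    obtain ⟨g, rfl⟩ := QuotientAddGroup.mk'_surjective _ m
    have h0 : q (p ^ (n + 1) • g) = 0 := (QuotientAddGroup.eq_zero_iff _).2 ⟨g, rfl⟩
    obtain ⟨j, hj⟩ := he ⟨φ (q g), by rw [← map_nsmul, ← map_nsmul, h0, map_zero]⟩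
    exact ⟨j + 1, congrArg Subtype.val hj⟩

/-- If all were infinite, the order of each `y i` could be chosen large enough for `y i` to be sent
to the prescribed `d i`. -/
lemma IsBassian.exists_finite_divisibleSocle {G : Type*} [AddCommGroup G] (hG : IsBassian G)
    {p : ℕ} (hp : p.Prime) : ∃ n, (divisibleSocle G p n : Set G).Finite := by
  by_contra! hinf
  obtain ⟨D, _, _, _, htor, hD⟩ := exists_divisible_primary p hp
  choose κ hκ using htor
  obtain ⟨e, he⟩ := exists_surjective_nat D
  let d : ℕ → D := fun i => i.casesOn 0 e
  obtain ⟨s, hs, hind⟩ := exists_independent_sequence hp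
    (fun i => (divisibleSocle G p (κ (d i)) : Set G)) (fun _ _ hx => hx.1) (fun _ => hinf _)
  choose hs y hy using hs
  obtain ⟨u, hu, hurel⟩ := hD fun i => κ (d i)
  refine not_isBassian_of_sequence hp (AddMonoidHom.id G) y (fun i => κ (d i)) ?_ ?_ d ?_ rfl ?_
    u hu hurel hG
  · intro i
    rw [pow_succ', mul_smul, hy, hs]
  · refine pow_dvd_of_relation hp.ne_zero y _ fun F b h => ?_
    simp only [hy] at h
    exact hind F b h
  · intro i
    rw [pow_succ', mul_smul, hκ, smul_zero]
  · intro φ m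
    obtain ⟨j, hj⟩ := he (φ m)
    exact ⟨j + 1, hj⟩

lemma IsBassian.finite_socle {G : Type*} [AddCommGroup G] (hG : IsBassian G)
    {p : ℕ} (hp : p.Prime) : (divisibleSocle G p 0 : Set G).Finite := by
  obtain ⟨n, hn⟩ := hG.exists_finite_divisibleSocle hp
  induction n with
  | zero => exact hn
  | succ n ih => exact ih (hG.finite_divisibleSocle_of_succ hp n hn)

/-- The subgroup `p ^ n T`, where `T` is the `p`-primary component of `G`. -/
def primaryMultiples (G : Type*) [AddCommGroup G] (p n : ℕ) : AddSubgroup G where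
  carrier := {x | (∃ k : ℕ, p ^ k • x = 0) ∧ ∃ g, p ^ n • g = x}
  zero_mem' := ⟨⟨0, smul_zero _⟩, 0, smul_zero _⟩
  add_mem' := by
    rintro _ _ ⟨⟨k, hk⟩, a, rfl⟩ ⟨⟨l, hl⟩, b, rfl⟩
    refine ⟨⟨k + l, ?_⟩, a + b, smul_add _ _ _⟩
    rw [smul_add, pow_add, mul_smul _ _ (p ^ n • b), hl, smul_zero, mul_comm, mul_smul, hk,
      smul_zero, zero_add]
  neg_mem' := by
    rintro _ ⟨⟨k, hk⟩, a, rfl⟩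
    exact ⟨⟨k, by rw [smul_neg, hk, neg_zero]⟩, -a, smul_neg _ _⟩

lemma exists_nsmul_eq_of_divisibleSocle_le {G : Type*} [AddCommGroup G] {p n : ℕ}
    (hstab : ∀ m, divisibleSocle G p n ≤ divisibleSocle G p m) {x : G}
    (hx : x ∈ primaryMultiples G p n) : ∃ y ∈ primaryMultiples G p n, p • y = x := by
  obtain ⟨⟨k, hk⟩, g, hg⟩ := hx
  have key : ∀ (k : ℕ) (x g : G), p ^ k • x = 0 → p ^ n • g = x → ∃ z, p ^ (n + 1) • z = x := by
    intro k
    induction k with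
    | zero => intro x g hx _; exact ⟨0, by simpa using hx.symm⟩
    | succ k ih =>
      intro x g hx hg
      -- Subtracting `p ^ (n + 1) • z` from `x` lowers the exponent of `p` that kills it.
      obtain ⟨-, z, hz⟩ := hstab (k + (n + 1)) (show p ^ k • x ∈ divisibleSocle G p n from
        ⟨by rw [smul_smul, ← pow_succ', hx], p ^ k • g, by rw [← hg, smul_comm]⟩)
      obtain ⟨w, hw⟩ := ih (x - p ^ (n + 1) • z) (g - p • z)
        (by rw [smul_sub, smul_smul, ← pow_add, hz, sub_self])
        (by rw [smul_sub, hg, smul_smul, pow_succ])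
      exact ⟨w + z, by rw [smul_add, hw, sub_add_cancel]⟩
  obtain ⟨z, hz⟩ := key k x g hk hg
  have hz' : p • p ^ n • z = x := by rw [smul_smul, ← pow_succ', hz]
  exact ⟨p ^ n • z, ⟨⟨k + 1, by rw [pow_succ, mul_smul, hz', hk]⟩, z, rfl⟩, hz'⟩

/-- A `p`-divisible `p`-primary group is divisible. -/
lemma exists_nsmul_eq_of_primary {T : Type*} [AddCommGroup T] {p : ℕ} (hp : p.Prime)
    (htor : ∀ x : T, ∃ k : ℕ, p ^ k • x = 0) (hdiv : ∀ x : T, ∃ y, p • y = x) {n : ℕ} (hn : n ≠ 0)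
    (x : T) : ∃ y, n • y = x := by
  obtain ⟨a, m, hm, rfl⟩ := Nat.exists_eq_pow_mul_and_not_dvd hn p hp.ne_one
  have hpow : ∀ a : ℕ, ∃ y, p ^ a • y = x := by
    intro a
    induction a with
    | zero => exact ⟨x, by simp⟩
    | succ a ih =>
      obtain ⟨y, hy⟩ := ih
      obtain ⟨z, hz⟩ := hdiv y
      exact ⟨z, by rw [pow_succ, mul_smul, hz, hy]⟩
  obtain ⟨w, hw⟩ := hpow a
  obtain ⟨k, hk⟩ := htor w
  obtain ⟨u, v, huv⟩ := Nat.isCoprime_iff_coprime.2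
    (Nat.Coprime.pow_left k ((Nat.Prime.coprime_iff_not_dvd hp).2 hm))
  refine ⟨v • w, ?_⟩
  rw [mul_smul, ← hw]
  congr 1
  rw [← natCast_zsmul, smul_smul]
  conv_rhs => rw [← one_smul ℤ w, ← huv, add_smul, mul_smul, natCast_zsmul, hk, smul_zero, zero_add]
  rw [mul_comm]

/-- Stability makes `p ^ n T` divisible, so its identity and its multiplication by `p` both extend
to `G`. The latter is onto, and a nonzero socle element lies in its kernel. -/
lemma IsBassian.divisibleSocle_eq_bot {G : Type*} [AddCommGroup G] (hG : IsBassian G)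
    {p : ℕ} (hp : p.Prime) {n : ℕ} (hstab : ∀ m, divisibleSocle G p n ≤ divisibleSocle G p m) :
    divisibleSocle G p n = ⊥ := by
  rw [eq_bot_iff]
  rintro x ⟨hpx, hx⟩
  by_contra hx0
  have hxT : x ∈ primaryMultiples G p n := ⟨⟨1, by rwa [pow_one]⟩, hx⟩
  have hdiv : ∀ x : primaryMultiples G p n, ∃ y, p • y = x := fun x => by
    obtain ⟨y, hy, h⟩ := exists_nsmul_eq_of_divisibleSocle_le hstab x.2
    exact ⟨⟨y, hy⟩, Subtype.ext h⟩
  let _ : DivisibleBy (primaryMultiples G p n) ℕ := divisibleByOfSMulRightSurj _ _ fun {m} hm x =>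
    exists_nsmul_eq_of_primary hp (fun x => x.2.1.imp fun k hk => Subtype.ext hk) hdiv hm x
  let _ := AddGroup.divisibleByIntOfDivisibleByNat (primaryMultiples G p n)
  have hext : ∀ a : ℕ, ∃ Φ : G →+ primaryMultiples G p n, ∀ i : primaryMultiples G p n,
      Φ i = a • i := fun a =>
    exists_addMonoidHom_of_relations _ _ fun F b h => by
      have h' : ∑ i ∈ F, b i • i = 0 := Subtype.ext (by simpa using h)
      calc ∑ i ∈ F, b i • a • i = a • ∑ i ∈ F, b i • i := by
            rw [Finset.smul_sum]
            exact Finset.sum_congr rfl fun i _ => smul_comm _ _ _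
        _ = 0 := by rw [h', smul_zero]
  obtain ⟨Φ, hΦ⟩ := hext p
  obtain ⟨Ψ, hΨ⟩ := hext 1
  refine not_isBassian_of_homs (primaryMultiples G p n) Φ Ψ ?_ ?_ hxT hx0 ?_ hG
  · intro g
    obtain ⟨c, hc⟩ := hdiv (Ψ g - Φ g)
    exact ⟨c, c.2, by rw [hΦ, hc]⟩
  · intro c hc h
    have := (hΨ ⟨c, hc⟩).symm.trans h
    simpa using this
  · exact (hΦ ⟨x, hxT⟩).trans (Subtype.ext hpx)

/-- The primary components of a Bassian group are finite. -/
lemma IsBassian.finite_primaryComponent {G : Type*} [AddCommGroup G] (hG : IsBassian G)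
    {p : ℕ} (hp : p.Prime) : (AddCommGroup.primaryComponent G p : Set G).Finite := by
  have h0 := hG.finite_socle hp
  obtain ⟨n, hn⟩ : ∃ n, ∀ m, divisibleSocle G p n ≤ divisibleSocle G p m := by
    let f : ℕ → ℕ := fun n => (divisibleSocle G p n : Set G).ncard
    refine ⟨Function.argmin f, fun m => ?_⟩
    set n := Function.argmin f
    have hle : (divisibleSocle G p (max n m) : Set G) ⊆ divisibleSocle G p n :=
      divisibleSocle_antitone G p (le_max_left n m)
    have heq := Set.eq_of_subset_of_ncard_le hle (Function.argmin_le f _)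
      (h0.subset (divisibleSocle_antitone G p (Nat.zero_le n)))
    rw [← SetLike.coe_subset_coe, ← heq]
    exact divisibleSocle_antitone G p (le_max_right n m)
  have hbot := hG.divisibleSocle_eq_bot hp hn
  have hzero : ∀ (k : ℕ) (g : G), p ^ k • p ^ n • g = 0 → p ^ n • g = 0 := by
    intro k g
    induction k with
    | zero => simp
    | succ k ih =>
      intro h
      refine ih ?_
      have : p ^ k • p ^ n • g ∈ divisibleSocle G p n :=
        ⟨by rw [smul_smul, ← pow_succ', h], p ^ k • g, smul_comm _ _ _⟩
      rwa [hbot, AddSubgroup.mem_bot] at this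
  have hfin : ∀ j : ℕ, {x : G | p ^ j • x = 0}.Finite := by
    intro j
    induction j with
    | zero => simp
    | succ j ih =>
      -- Nonempty fibres of multiplication by `p` are cosets of the finite socle.
      refine Set.Finite.of_finite_fibers (p • ·) (ih.subset ?_) ?_
      · rintro _ ⟨x, hx, rfl⟩
        have hx : p ^ (j + 1) • x = 0 := hx
        rwa [pow_succ, mul_smul] at hx
      · rintro _ ⟨x, hx, rfl⟩
        refine (h0.image (x + ·)).subset ?_
        rintro z ⟨hz, hzx⟩
        have hzx : p • z = p • x := hzx
        exact ⟨z - x, ⟨by rw [smul_sub, hzx, sub_self], z - x, by simp⟩, by simp⟩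
  refine (hfin n).subset ?_
  rintro x ⟨k, hk⟩
  exact hzero k x (by rw [smul_comm]; exact (congrArg _ hk).trans (smul_zero _))

/-! ### The converse, and passage to subgroups -/

/-- A group of finite torsion-free rank with finite primary components is Bassian. -/
lemma isBassian_of_finite {G : Type*} [AddCommGroup G]
    (hr : Module.rank ℤ G < Cardinal.aleph0)
    (hfin : ∀ p : ℕ, p.Prime → (AddCommGroup.primaryComponent G p : Set G).Finite) :
    IsBassian G := by
  rintro N ⟨f, hf⟩
  set π := QuotientAddGroup.mk' N
  have hπ : ∀ x, π x = 0 ↔ x ∈ N := fun x => QuotientAddGroup.eq_zero_iff x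
  -- Additivity of the finite rank forces `N` to be torsion.
  have hker : Module.rank ℤ (LinearMap.ker π.toIntLinearMap) = 0 := by
    have h1 := LinearMap.rank_range_add_rank_ker π.toIntLinearMap
    rw [LinearMap.range_eq_top.2 (QuotientAddGroup.mk'_surjective N), rank_top] at h1
    have h2 := LinearMap.rank_le_of_injective f.toIntLinearMap hf
    have h3 : Module.rank ℤ (G ⧸ N) < Cardinal.aleph0 :=
      lt_of_le_of_lt (by rw [← h1]; exact self_le_add_right _ _) hr
    have h4 : Module.rank ℤ (LinearMap.ker π.toIntLinearMap) < Cardinal.aleph0 :=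
      lt_of_le_of_lt (by rw [← h1]; exact self_le_add_left _ _) hr
    obtain ⟨a, ha⟩ := Cardinal.lt_aleph0.1 h3
    obtain ⟨b, hb⟩ := Cardinal.lt_aleph0.1 h4
    rw [← h1, ha, hb] at h2
    have h5 : a + b ≤ a := by exact_mod_cast h2
    rw [hb, show b = 0 by omega, Nat.cast_zero]
  have htor : ∀ x ∈ N, ∃ n : ℕ, n ≠ 0 ∧ n • x = 0 := by
    intro x hx
    obtain ⟨a, ha, h⟩ := rank_eq_zero_iff.1 hker ⟨x, (hπ x).2 hx⟩
    have h' : a • x = 0 := congrArg Subtype.val h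
    exact ⟨a.natAbs, Int.natAbs_ne_zero.2 ha, natAbs_nsmul_eq_zero.2 h'⟩
  rw [eq_bot_iff]
  intro x hx
  by_contra hx0
  rw [AddSubgroup.mem_bot] at hx0
  obtain ⟨n, hn, hnx⟩ := htor x hx
  have hord : addOrderOf x ≠ 0 := fun h => hn (by simpa [h] using addOrderOf_dvd_of_nsmul_eq_zero hnx)
  obtain ⟨p, hp, c, hc⟩ :=
    Nat.exists_prime_and_dvd (n := addOrderOf x) fun h => hx0 (AddMonoid.addOrderOf_eq_one_iff.1 h)
  have hcx0 : c • x ≠ 0 := by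
    intro h
    have h2 : 0 < c := Nat.pos_of_ne_zero fun h => hord (by rw [hc, h, mul_zero])
    have h1 := Nat.le_of_dvd h2 (addOrderOf_dvd_of_nsmul_eq_zero h)
    rw [hc] at h1
    nlinarith [hp.two_le]
  have hcxp : p • c • x = 0 := by rw [smul_smul, ← hc, addOrderOf_nsmul_eq_zero]
  set T : Set G := (AddCommGroup.primaryComponent G p : Set G)
  -- A lift `g` of `f t` agrees modulo `N` with a multiple of `m • g`, which is `p`-primary.
  -- Counting then makes `π` injective on `T`, so `N` has no element of order `p`.
  have hsub : ∀ t ∈ T, f t ∈ π '' T := by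
    rintro t ⟨k, hk⟩
    obtain ⟨g, hg⟩ := QuotientAddGroup.mk'_surjective N (f t)
    have hgN : p ^ k • g ∈ N := by
      rw [← hπ, map_nsmul, hg, ← map_nsmul]
      exact (congrArg f hk).trans (map_zero f)
    obtain ⟨n, hn, h⟩ := htor _ hgN
    obtain ⟨b, m, hm, rfl⟩ := Nat.exists_eq_pow_mul_and_not_dvd hn p hp.ne_one
    obtain ⟨v, w, hvw⟩ := Nat.isCoprime_iff_coprime.2
      (Nat.Coprime.pow_left k ((Nat.Prime.coprime_iff_not_dvd hp).2 hm))
    have hmg : m • g ∈ AddCommGroup.primaryComponent G p := by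
      refine ⟨b + k, ?_⟩
      have : p ^ (b + k) • m • g = (p ^ b * m) • p ^ k • g := by
        rw [smul_smul, smul_smul]
        congr 1
        ring
      exact this.trans h
    refine ⟨w • m • g, zsmul_mem hmg w, ?_⟩
    rw [← hg]
    have h1 : g = v • p ^ k • g + w • m • g := by
      rw [← natCast_zsmul g, ← natCast_zsmul g, smul_smul, smul_smul, ← add_smul, hvw, one_smul]
    conv_rhs => rw [h1, map_add, (hπ _).2 (zsmul_mem hgN v), zero_add]
  have hTfin := hfin p hp
  have hle : T.ncard ≤ (π '' T).ncard :=
    Set.ncard_le_ncard_of_injOn f hsub hf.injOn (hTfin.image _)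
  have hinj := Set.injOn_of_ncard_image_eq (le_antisymm (Set.ncard_image_le hTfin) hle) hTfin
  refine hcx0 (hinj ⟨1, ?_⟩ (zero_mem (AddCommGroup.primaryComponent G p)) ?_)
  · simpa using hcxp
  · rw [map_zero]
    exact (hπ _).2 (nsmul_mem hx c)

/-- A group that embeds in a Bassian group is Bassian. -/
lemma IsBassian.of_injective {A K : Type*} [AddCommGroup A] [AddCommGroup K] (hA : IsBassian A)
    (f : K →+ A) (hf : Function.Injective f) : IsBassian K := by
  refine isBassian_of_finite ?_ fun p hp => ?_
  · have h := LinearMap.lift_rank_le_of_injective f.toIntLinearMap hf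
    have h2 := h.trans_lt (Cardinal.lift_lt_aleph0.2 hA.rank_lt_aleph0)
    exact Cardinal.lift_lt_aleph0.1 h2
  · refine Set.Finite.of_finite_image ((hA.finite_primaryComponent hp).subset ?_) hf.injOn
    rintro _ ⟨x, ⟨k, hk⟩, rfl⟩
    exact ⟨k, by rw [← map_nsmul]; exact (congrArg f hk).trans (map_zero f)⟩

/-! ### Elementary groups -/

lemma IsElementaryTorsion.of_injective {A K : Type*} [AddCommGroup A] [AddCommGroup K]
    (hA : IsElementaryTorsion A) (f : K →+ A) (hf : Function.Injective f) :
    IsElementaryTorsion K := by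
  refine ⟨fun x => ?_, fun p hp x hx => ?_⟩
  · exact (Function.Injective.isOfFinAddOrder_iff hf).1 (hA.1 (f x))
  · obtain ⟨k, hk⟩ := hx
    refine hf ?_
    rw [map_nsmul, map_zero]
    exact hA.2 p hp (f x) ⟨k, by rw [← map_nsmul]; exact (congrArg f hk).trans (map_zero f)⟩

/-- Elementary torsion groups are semisimple. -/
lemma IsElementaryTorsion.isSemisimpleModule {E : Type*} [AddCommGroup E]
    (hE : IsElementaryTorsion E) : IsSemisimpleModule ℤ E := by
  refine .of_sSup_simples_eq_top ?_
  set S := sSup {m : Submodule ℤ E | IsSimpleModule ℤ m}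
  rw [eq_top_iff]
  have key : ∀ n : ℕ, 0 < n → ∀ x : E, n • x = 0 → x ∈ S := by
    intro n
    induction n using Nat.recOnPosPrimePosCoprime with
    | zero => simp
    | one => intro _ x hx; simp_all
    | prime_pow p k hp hk =>
      intro _ x hx
      have hpx := hE.2 p hp x ⟨k, hx⟩
      by_cases hx0 : x = 0
      · rw [hx0]; exact zero_mem _
      refine (le_sSup (?_ : Submodule.span ℤ {x} ∈ _) : _ ≤ S) (Submodule.mem_span_singleton_self x)
      refine isSimpleModule_iff_isAtom.2 ⟨by simpa using hx0, fun B hB => ?_⟩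
      rw [eq_bot_iff]
      intro z hz
      by_contra hz0
      obtain ⟨c, rfl⟩ := Submodule.mem_span_singleton.1 (hB.le hz)
      have hpc : ¬ (p : ℤ) ∣ c := by
        rintro ⟨e, rfl⟩
        exact hz0 (by simp [mul_comm, mul_smul, hpx])
      obtain ⟨v, w, hvw⟩ := ((Nat.prime_iff_prime_int.1 hp).coprime_iff_not_dvd).2 hpc
      have hxB : x = w • c • x := by
        conv_lhs => rw [← one_smul ℤ x, ← hvw, add_smul, mul_smul, natCast_zsmul, hpx, smul_zero,
          zero_add, mul_smul]
      refine hB.not_ge ((Submodule.span_singleton_le_iff_mem _ _).2 ?_)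
      rw [hxB]
      exact B.smul_mem w hz
    | coprime a b ha hb hab iha ihb =>
      intro _ x hx
      obtain ⟨v, w, hvw⟩ := Nat.isCoprime_iff_coprime.2 hab
      have h1 : x = v • a • x + w • b • x := by
        rw [← natCast_zsmul x, ← natCast_zsmul x, smul_smul, smul_smul, ← add_smul, hvw, one_smul]
      rw [h1]
      refine add_mem (S.smul_mem _ (ihb (by omega) _ ?_)) (S.smul_mem _ (iha (by omega) _ ?_))
      · rw [smul_smul, mul_comm, hx]
      · rw [smul_smul, hx]
  intro x _
  obtain ⟨n, hn, hx⟩ := isOfFinAddOrder_iff_nsmul_eq_zero.1 (hE.1 x)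
  exact key n hn x hx

/-- Every subgroup of an elementary torsion group is a direct summand. -/
lemma IsElementaryTorsion.exists_isCompl {E : Type*} [AddCommGroup E]
    (hE : IsElementaryTorsion E) (B : AddSubgroup E) : ∃ C, IsCompl B C := by
  have := hE.isSemisimpleModule
  obtain ⟨C, hC⟩ := ComplementedLattice.exists_isCompl (AddSubgroup.toIntSubmodule B)
  exact ⟨AddSubgroup.toIntSubmodule.symm C,
    by simpa using (AddSubgroup.toIntSubmodule.symm.isCompl_iff).1 hC⟩

/-! ### Splitting the subgroup -/

theorem corollary3p3 {G : Type*} [AddCommGroup G] (hG : IsBPlusE G) (H : AddSubgroup G) :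
    IsBPlusE H := by
  obtain ⟨A, E, hAE, hA, hE⟩ := hG
  obtain ⟨C, hC⟩ := hE.exists_isCompl (H.comap E.subtype)
  have hdisj : ∀ x ∈ H, x ∈ E → x ∈ A ⊔ C.map E.subtype → x = 0 := by
    intro x hxH hxE hx
    obtain ⟨a, ha, _, ⟨e, he, rfl⟩, rfl⟩ := AddSubgroup.mem_sup.1 hx
    have haE : a ∈ E := by simpa using sub_mem hxE e.2
    obtain rfl : a = 0 := AddSubgroup.disjoint_def.1 hAE.disjoint ha haE
    rw [zero_add] at hxH ⊢
    rw [AddSubgroup.disjoint_def.1 hC.disjoint (x := e) hxH he, map_zero]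
  refine ⟨(A ⊔ C.map E.subtype).comap H.subtype, E.comap H.subtype, ⟨?_, ?_⟩, ?_, ?_⟩
  · rw [AddSubgroup.disjoint_def]
    exact fun {x} h1 h2 => Subtype.ext (hdisj x x.2 h2 h1)
  · rw [codisjoint_iff, eq_top_iff]
    rintro ⟨x, hxH⟩ -
    obtain ⟨a, ha, e, he, rfl⟩ := AddSubgroup.mem_sup.1
      (show x ∈ A ⊔ E from hAE.sup_eq_top ▸ AddSubgroup.mem_top x)
    obtain ⟨b, hb, c, hc, hbc⟩ := AddSubgroup.mem_sup.1
      (show (⟨e, he⟩ : E) ∈ H.comap E.subtype ⊔ C from hC.sup_eq_top ▸ AddSubgroup.mem_top _)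
    have hbc' : (b : G) + c = e := congrArg Subtype.val hbc
    have hb : (b : G) ∈ H := hb
    have hac : a + c ∈ H := by
      have := sub_mem hxH hb
      rwa [← hbc', show a + ((b : G) + c) - b = a + c by abel] at this
    refine AddSubgroup.mem_sup.2 ⟨⟨a + c, hac⟩, AddSubgroup.add_mem_sup ha ⟨c, hc, rfl⟩,
      ⟨b, hb⟩, b.2, Subtype.ext ?_⟩
    change a + (c : G) + b = a + e
    rw [← hbc']
    abel
  · have hAE' := (AddSubgroup.toIntSubmodule.isCompl_iff).1 hAE
    let π : G →+ A := (Submodule.projectionOnto _ _ hAE').toAddMonoidHom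
    have hπ : ∀ x, π x = 0 → x ∈ E := fun x hx =>
      (Submodule.projectionOnto_apply_eq_zero_iff hAE').1 hx
    refine hA.of_injective ((π.comp H.subtype).comp (AddSubgroup.subtype _)) ?_
    rw [injective_iff_map_eq_zero]
    exact fun x hx => Subtype.ext (Subtype.ext (hdisj x x.1.2 (hπ _ hx) x.2))
  · refine hE.of_injective ((H.subtype.comp (AddSubgroup.subtype _)).codRestrict E fun x => x.2) ?_
    intro x y h
    exact Subtype.ext (Subtype.ext (congrArg E.subtype h))
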